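/- Let $n,k\ge 0$ be integers. A permutation $\sigma=\sigma_1\cdots\sigma_{2n+1}$ of $\{1,\dots,2n+1\}$, with the convention $\sigma_0=\sigma_{2n+2}=0$, is called an $\mathcal F$-permutation if (i) every descent $\sigma_i>\sigma_{i+1}$ ($1\le i\le 2n$) is odd-odd, i.e. $\sigma_i$ and $\sigma_{i+1}$ are both odd; (ii) $\sigma_{2n+1}$ is odd and $\sigma_{2n}<\sigma_{2n+1}$; (iii) $\sigma$ has no double descent, i.e. there is no $i\in\{1,\dots,2n+1\}$ with $\sigma_{i-1}>\sigma_i>\sigma_{i+1}$. Let $\overline{\mathcal Y}^*_{2n+1,k}$ be the set of $\mathcal F$-permutations of $\{1,\dots,2n+1\}$ with exactly $k$ descents. Let $\operatorname{lema}\sigma$ be the number of even left-to-right maxima of $\sigma$, let $\operatorname{res}\sigma$ be the number of pairs $1\le i<j\le 2n$ with $\sigma_{j+1}>\sigma_i>\sigma_j$, and let $\operatorname{les}\sigma$ be the number of pairs $2\le i<j\le 2n+1$ with $\sigma_{i-1}>\sigma_j>\sigma_i$. For a value $x$, let $\operatorname{les}_\sigma(x)$ be the number of the latter pairs with $\sigma_j=x$.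 The $\gamma$-coefficients of the odd-odd model are $$\gamma_{n,k}(a,p,q)=\sum_{\sigma\in\overline{\mathcal Y}^*_{2n+1,k}}a^{\operatorname{lema}\sigma}p^{\operatorname{res}\sigma}q^{\operatorname{les}\sigma}.$$ The value $\sigma_i$ is a peak if $\sigma_{i-1}<\sigma_i>\sigma_{i+1}$ and a valley if $\sigma_{i-1}>\sigma_i<\sigma_{i+1}$. Put $a_\sigma(j)=f(j)-g(j)+1$, where $f(j)$ and $g(j)$ are the numbers of valleys and of peaks of $\sigma$ that are less than $j$. For $1\le i\le n$, the pair $x=\{2i-1,2i\}$ is a VOP pair of $\sigma$ if $2i-1$ is a valley or a peak of $\sigma$; its embracing number is $l_\sigma(x)=\operatorname{les}_\sigma(2i-1)$ if $a_\sigma(2i-1)$ is even and $l_\sigma(x)=\operatorname{les}_\sigma(2i)$ if $a_\sigma(2i-1)$ is odd. An $\mathcal F$-permutation is normalized if $l_\sigma(x)$ is even for every VOP pair $x$ of $\sigma$. Let $\widehat{\mathcal Y}^*_{2n+1,k}$ be the set of normalized $\mathcal F$-permutations of $\{1,\dots,2n+1\}$ with exactly $k$ descents. Theorem. Every $\sigma\in\widehat{\mathcal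 Y}^*_{2n+1,k}$ satisfies $\operatorname{res}\sigma\ge 2k$, and $$\gamma_{n,k}(1,p,q)=(p+q)^{2k}\sum_{\sigma\in\widehat{\mathcal Y}^*_{2n+1,k}}p^{\operatorname{res}\sigma-2k}\,q^{\operatorname{les}\sigma}$$ as polynomials in $p,q$ (equivalently, for all elements $p,q$ of every commutative semiring). -/

import Mathlib

namespace OddOdd

open Finset

/-- The word `σ₁ σ₂ … σ_m` of a permutation of `{1, …, m}` (a permutation of `Fin m` with all
positions and values shifted by one), with the convention `σ₀ = σ_{m+1} = 0`. -/
def entry {m : ℕ} (σ : Equiv.Perm (Fin m)) (i : ℕ) : ℕ :=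
  if h : 1 ≤ i ∧ i ≤ m then (σ ⟨i - 1, by omega⟩ : ℕ) + 1 else 0

/-- Positions `i` with `1 ≤ i < m` and `σ_i > σ_{i+1}`. -/
def descents {m : ℕ} (σ : Equiv.Perm (Fin m)) : Finset ℕ :=
  (Ico 1 m).filter fun i => entry σ i > entry σ (i + 1)

def des {m : ℕ} (σ : Equiv.Perm (Fin m)) : ℕ := (descents σ).card

/-- Pairs `(i, j)` with `2 ≤ i < j ≤ m` and `σ_{i-1} > σ_j > σ_i`. -/
def lesPairs {m : ℕ} (σ : Equiv.Perm (Fin m)) : Finset (ℕ × ℕ) :=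
  (Icc 2 m ×ˢ Icc 2 m).filter fun z =>
    z.1 < z.2 ∧ entry σ (z.1 - 1) > entry σ z.2 ∧ entry σ z.2 > entry σ z.1

def les {m : ℕ} (σ : Equiv.Perm (Fin m)) : ℕ := (lesPairs σ).card

/-- The number of left-embracings of the value `x`: pairs `(i, j)` counted by `les` with
`σ_j = x`. -/
def leftEmbracings {m : ℕ} (σ : Equiv.Perm (Fin m)) (x : ℕ) : ℕ :=
  ((lesPairs σ).filter fun z => entry σ z.2 = x).card

/-- The number of pairs `(i, j)` with `1 ≤ i < j ≤ m - 1` and `σ_{j+1} > σ_i > σ_j`. -/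
def res {m : ℕ} (σ : Equiv.Perm (Fin m)) : ℕ :=
  ((Ico 1 m ×ˢ Ico 1 m).filter fun z =>
    z.1 < z.2 ∧ entry σ (z.2 + 1) > entry σ z.1 ∧ entry σ z.1 > entry σ z.2).card

/-- The number of even left-to-right maxima. -/
def lema {m : ℕ} (σ : Equiv.Perm (Fin m)) : ℕ :=
  ((Icc 1 m).filter fun j =>
    Even (entry σ j) ∧ ∀ i < j, 1 ≤ i → entry σ i < entry σ j).card

/-- The set of values `σ_i` with `σ_{i-1} < σ_i > σ_{i+1}`. -/
def peaks {m : ℕ} (σ : Equiv.Perm (Fin m)) : Finset ℕ :=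
  ((Icc 1 m).filter fun i =>
    entry σ (i - 1) < entry σ i ∧ entry σ i > entry σ (i + 1)).image (entry σ)

/-- The set of values `σ_i` with `σ_{i-1} > σ_i < σ_{i+1}`. -/
def valleys {m : ℕ} (σ : Equiv.Perm (Fin m)) : Finset ℕ :=
  ((Icc 1 m).filter fun i =>
    entry σ (i - 1) > entry σ i ∧ entry σ i < entry σ (i + 1)).image (entry σ)

/-- The set of values `σ_i` with `σ_{i-1} > σ_i > σ_{i+1}`. -/
def doubleDescents {m : ℕ} (σ : Equiv.Perm (Fin m)) : Finset ℕ :=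
  ((Icc 1 m).filter fun i =>
    entry σ (i - 1) > entry σ i ∧ entry σ i > entry σ (i + 1)).image (entry σ)

/-- All descents of `σ` are odd-odd, and `σ` ends with an odd entry. -/
def IsOddOddEndingOdd (n : ℕ) (σ : Equiv.Perm (Fin (2 * n + 1))) : Prop :=
  (∀ i ∈ descents σ, Odd (entry σ i) ∧ Odd (entry σ (i + 1))) ∧ Odd (entry σ (2 * n + 1))

instance (n : ℕ) : DecidablePred (IsOddOddEndingOdd n) := fun σ => by
  unfold IsOddOddEndingOdd; infer_instance

/-- `F`-permutations. -/
def IsF (n : ℕ) (σ : Equiv.Perm (Fin (2 * n + 1))) : Prop :=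
  IsOddOddEndingOdd n σ ∧ doubleDescents σ = ∅ ∧ entry σ (2 * n) < entry σ (2 * n + 1)

instance (n : ℕ) : DecidablePred (IsF n) := fun σ => by
  unfold IsF; infer_instance

/-- `a(j) = f(j) - g(j) + 1`, where `f(j)` and `g(j)` are the numbers of valleys and of peaks
less than `j`. -/
def height {m : ℕ} (σ : Equiv.Perm (Fin m)) (j : ℕ) : ℤ :=
  (((valleys σ).filter (· < j)).card : ℤ) - (((peaks σ).filter (· < j)).card : ℤ) + 1

/-- `{2i-1, 2i}` is a VOP pair: `2i-1` is a valley or a peak. -/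
def IsVOP {m : ℕ} (σ : Equiv.Perm (Fin m)) (i : ℕ) : Prop :=
  2 * i - 1 ∈ valleys σ ∨ 2 * i - 1 ∈ peaks σ

instance {m : ℕ} (σ : Equiv.Perm (Fin m)) : DecidablePred (IsVOP σ) := fun i => by
  unfold IsVOP; infer_instance

/-- The embracing number of the pair `{2i-1, 2i}`. -/
def pairEmbracing {m : ℕ} (σ : Equiv.Perm (Fin m)) (i : ℕ) : ℕ :=
  if Even (height σ (2 * i - 1)) then leftEmbracings σ (2 * i - 1) else leftEmbracings σ (2 * i)

/-- Normalized `F`-permutations. -/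
def IsNormalizedF (n : ℕ) (σ : Equiv.Perm (Fin (2 * n + 1))) : Prop :=
  IsF n σ ∧ ∀ i ∈ Icc 1 n, IsVOP σ i → Even (pairEmbracing σ i)

instance (n : ℕ) : DecidablePred (IsNormalizedF n) := fun σ => by
  unfold IsNormalizedF; infer_instance

/-- `F`-permutations of `{1, …, 2n+1}` with `k` descents. -/
def FPerms (n k : ℕ) : Finset (Equiv.Perm (Fin (2 * n + 1))) :=
  univ.filter fun σ => IsF n σ ∧ des σ = k

/-- Normalized `F`-permutations of `{1, …, 2n+1}` with `k` descents. -/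
def normalizedFPerms (n k : ℕ) : Finset (Equiv.Perm (Fin (2 * n + 1))) :=
  univ.filter fun σ => IsNormalizedF n σ ∧ des σ = k

/-- The coefficient `γ_{n,k}(a, p, q)`, evaluated at elements of a commutative semiring. -/
def gammaCoeff {R : Type*} [CommSemiring R] (n k : ℕ) (a p q : R) : R :=
  ∑ σ ∈ FPerms n k, a ^ lema σ * p ^ res σ * q ^ les σ

end OddOdd

namespace OddOdd

open Finset

/-! Insert the values 1, 2, 3, … in increasing order into gaps, the places reserved for larger
letters. The history of a permutation records, for each value, which of its neighbours are larger
and the index l of the gap it enters. Erasing the largest value undoes an insertion, so permutations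
correspond to valid histories that end with no gap (`IsGood.exists_build`, `build_injective`,
`exists_perm_of_history`). If x is inserted when there are a gaps, the gaps to the left of the
chosen one become the descents passing over x before it, and those to the right become the ascents
passing over x after it. Hence x contributes l to les and a - 1 - l to res (`hasData_build`,
`IsHistoryOf.embracings`), and a is the height of x (`IsHistoryOf.height_eq`).

In these terms, being an F-permutation means that no odd value is a double descent and every even
value is a double ascent (`IsHistoryOf.isF_iff`). The gap choices for the pair {2i-1, 2i}, made
among a and then a' gaps, are therefore free, and they contribute a product of two sums of the form
∑ p^(a-1-l) q^l. In a VOP pair a' = a ± 1, so exactly one of the two sums has an even number of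
terms. Grouping consecutive terms, that sum is p + q times its part with l even
(`sum_range_even_eq`), and the restriction to even l is exactly normalization. `sum_fHistories_eq`
collects one such factor from each VOP pair.

Counting gaps gives twice the descents plus one as VOP pairs plus gaps
(`two_mul_descentCount_add_one`). One gap is left for 2n+1, which contributes to neither statistic,
so there are 2k VOP pairs. The bound on res holds because an even l below an even a is never a - 1:
each VOP pair leaves a gap to the right (`vopCount_le_resSum`). -/

/-! ### Histories of gap insertions -/

/-- A step of a history: whether the left and the right neighbour of the inserted value are larger,
and the index of the gap that receives the value. -/
abbrev Step := Bool × Bool × ℕ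

/-- The number of gaps after a history (the latest step comes first). -/
def gaps : List Step → ℕ
  | [] => 1
  | s :: h => gaps h + s.1.toNat + s.2.1.toNat - 1

/-- Every step uses an existing gap. -/
def Valid : List Step → Prop
  | [] => True
  | s :: h => Valid h ∧ s.2.2 < gaps h

/-- The valid histories of length `r`. -/
def histories : ℕ → Finset (List Step)
  | 0 => {[]}
  | r + 1 => (histories r).biUnion fun h => (univ ×ˢ univ ×ˢ range (gaps h)).image (· :: h)

theorem mem_histories {r : ℕ} {h : List Step} : h ∈ histories r ↔ h.length = r ∧ Valid h := by
  induction r generalizing h with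
  | zero =>
    cases h <;> simp [histories, Valid]
  | succ r ih =>
    cases h with
    | nil => simp [histories]
    | cons s h =>
      simp only [histories, mem_biUnion, mem_image, mem_product, mem_univ, mem_range, true_and,
        List.cons.injEq, List.length_cons, Nat.add_right_cancel_iff, Valid]
      constructor
      · rintro ⟨h', hh', s', hs', rfl, rfl⟩
        exact ⟨(ih.1 hh').1, (ih.1 hh').2, hs'⟩
      · rintro ⟨h1, h2, h3⟩
        exact ⟨h, ih.2 ⟨h1, h2⟩, s, h3, rfl, rfl⟩

theorem sum_histories_succ {R : Type*} [AddCommMonoid R] (r : ℕ) (F : List Step → R) :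
    ∑ h ∈ histories (r + 1), F h =
      ∑ h ∈ histories r, ∑ b, ∑ c, ∑ l ∈ range (gaps h), F ((b, c, l) :: h) := by
  rw [histories, sum_biUnion]
  · refine sum_congr rfl fun h _ => ?_
    rw [sum_image (by intro a _ b _ hab; simpa using hab), sum_product]
    refine sum_congr rfl fun b _ => ?_
    rw [sum_product]
  · intro h _ h' _ hne
    rw [Function.onFun, Finset.disjoint_left]
    intro x hx hx'
    simp only [mem_image] at hx hx'
    obtain ⟨s, _, rfl⟩ := hx
    obtain ⟨s', _, hs'⟩ := hx'
    simp only [List.cons.injEq] at hs'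
    exact hne hs'.2.symm

/-! ### Words with gap markers and their bijection with histories -/

/-- What replaces the chosen gap when `x` is inserted; `N` marks a gap. -/
def pattern (N x : ℕ) (s : Step) : List ℕ :=
  (if s.1 then [N] else []) ++ x :: (if s.2.1 then [N] else [])

/-- Replace the `l`-th letter `N` (counting from zero) of a word. -/
def replaceNth (N : ℕ) (pat : List ℕ) : ℕ → List ℕ → List ℕ
  | _, [] => []
  | 0, a :: t => if a = N then pat ++ t else a :: replaceNth N pat 0 t
  | l + 1, a :: t => a :: if a = N then replaceNth N pat l t else replaceNth N pat (l + 1) t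

theorem replaceNth_append (N : ℕ) (pat A B : List ℕ) :
    replaceNth N pat (A.count N) (A ++ N :: B) = A ++ pat ++ B := by
  induction A with
  | nil => simp [replaceNth]
  | cons a A ih =>
    by_cases ha : a = N
    · subst ha
      simp [replaceNth] at ih ⊢
      exact ih
    · rw [List.count_cons_of_ne ha]
      cases hc : A.count N with
      | zero => rw [hc] at ih; simp [replaceNth, ha] at ih ⊢; exact ih
      | succ k => rw [hc] at ih; simp [replaceNth, ha] at ih ⊢; exact ih

theorem exists_split_of_lt_count {N l : ℕ} {w : List ℕ} (h : l < w.count N) :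
    ∃ A B, w = A ++ N :: B ∧ A.count N = l := by
  induction w generalizing l with
  | nil => simp at h
  | cons a t ih =>
    by_cases ha : a = N
    · subst ha
      cases l with
      | zero => exact ⟨[], t, rfl, rfl⟩
      | succ l =>
        obtain ⟨A, B, rfl, hA⟩ := ih (l := l) (by simpa using h)
        exact ⟨a :: A, B, rfl, by simp [hA]⟩
    · rw [List.count_cons_of_ne ha] at h
      obtain ⟨A, B, rfl, hA⟩ := ih h
      exact ⟨a :: A, B, rfl, by rw [List.count_cons_of_ne ha, hA]⟩

/-- The word of a history. -/
def build (N : ℕ) : List Step → List ℕ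
  | [] => [N]
  | s :: h => replaceNth N (pattern N (h.length + 1) s) s.2.2 (build N h)

/-- Words with values `1, …, r`, each once, and isolated gap markers `N`. -/
structure IsGood (N r : ℕ) (w : List ℕ) : Prop where
  ne_nil : w ≠ []
  mem : ∀ y ∈ w, y ≠ N → 1 ≤ y ∧ y ≤ r
  count : ∀ y, 1 ≤ y → y ≤ r → w.count y = 1
  chain : w.IsChain fun a b => ¬(a = N ∧ b = N)

theorem IsGood.insert {N r : ℕ} (hN : r + 1 < N) {A B : List ℕ} (s : Step)
    (h : IsGood N r (A ++ N :: B)) : IsGood N (r + 1) (A ++ pattern N (r + 1) s ++ B) := by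
  obtain ⟨_, h2, h3, h4⟩ := h
  obtain ⟨b, c, l⟩ := s
  refine ⟨by simp [pattern], ?_, ?_, ?_⟩
  · intro y hy hyN
    have := h2 y
    cases b <;> cases c <;> simp [pattern] at hy this ⊢ <;> grind
  · intro y hy1 hy2
    have h0 := h3 y hy1
    have h5 : r + 1 ∉ A ++ N :: B := fun hm => by
      have := h2 _ hm (by omega)
      omega
    have h6 : N ≠ y := by omega
    have h7 : (A ++ N :: B).count (r + 1) = 0 := List.count_eq_zero.2 h5
    simp only [List.count_append, List.count_cons] at h0 h7
    cases b <;> cases c <;>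
      simp only [pattern, List.count_append, List.count_cons, List.count_nil, if_true,
        Bool.false_eq_true, if_false] <;> grind
  · simp only [List.isChain_append, List.isChain_cons] at h4
    cases b <;> cases c <;>
      simp only [pattern, List.isChain_append, List.isChain_cons, if_true,
        Bool.false_eq_true, if_false, List.append_assoc] <;> grind

theorem exists_prefix_trailing {N : ℕ} (P : List ℕ) (h : P.IsChain fun a b => ¬(a = N ∧ b = N)) :
    ∃ A, ∃ b : Bool, P = A ++ (if b then [N] else []) ∧ A.getLast? ≠ some N := by
  rcases P.eq_nil_or_concat with rfl | ⟨A, a, rfl⟩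
  · exact ⟨[], false, by simp, by simp⟩
  · by_cases ha : a = N
    · subst ha
      refine ⟨A, true, by simp, fun hA => ?_⟩
      rw [List.concat_eq_append, List.isChain_append] at h
      exact h.2.2 a hA a (by simp) ⟨rfl, rfl⟩
    · exact ⟨A ++ [a], false, by simp, by simpa using ha⟩

theorem exists_suffix_leading {N : ℕ} (P : List ℕ) (h : P.IsChain fun a b => ¬(a = N ∧ b = N)) :
    ∃ B, ∃ c : Bool, P = (if c then [N] else []) ++ B ∧ B.head? ≠ some N := by
  cases P with
  | nil => exact ⟨[], false, by simp, by simp⟩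
  | cons a B =>
    by_cases ha : a = N
    · subst ha
      refine ⟨B, true, by simp, fun hB => ?_⟩
      rw [List.isChain_cons] at h
      exact h.1 a hB ⟨rfl, rfl⟩
    · exact ⟨a :: B, false, by simp, by simpa using ha⟩

/-- The inverse of an insertion: the largest value, together with any markers adjacent to it,
collapses to a single marker. Taking all adjacent markers keeps the remaining ones isolated. -/
theorem IsGood.split {N r : ℕ} (hN : r + 1 < N) {w : List ℕ} (h : IsGood N (r + 1) w) :
    ∃ A B s, w = A ++ pattern N (r + 1) s ++ B ∧ IsGood N r (A ++ N :: B) ∧ s.2.2 = A.count N := by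
  obtain ⟨_, h2, h3, h4⟩ := h
  have hm : r + 1 ∈ w := List.count_pos_iff.1 (by rw [h3 _ (by omega) le_rfl]; exact one_pos)
  obtain ⟨P, Q, rfl⟩ := List.append_of_mem hm
  have h4' := h4
  rw [List.isChain_append, List.isChain_cons] at h4'
  obtain ⟨A, b, rfl, hA⟩ := exists_prefix_trailing P h4'.1
  obtain ⟨B, c, rfl, hB⟩ := exists_suffix_leading Q h4'.2.1.2
  refine ⟨A, B, (b, c, A.count N), by simp [pattern], ⟨by simp, ?_, ?_, ?_⟩, rfl⟩
  · intro y hy hyN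
    have h5 := h3 (r + 1) (by omega) le_rfl
    simp only [List.count_append, List.count_cons, beq_self_eq_true, if_true] at h5
    have h6 : y ≠ r + 1 := by
      intro h6
      have h7 : r + 1 ∈ A ∨ r + 1 ∈ B := by simpa [hyN, ← h6] using hy
      rcases h7 with h | h <;> have := List.count_pos_iff.2 h <;> omega
    have := h2 y (by simp at hy ⊢; grind) hyN
    omega
  · intro y hy1 hy2
    have h0 := h3 y hy1 (by omega)
    simp only [List.count_append, List.count_cons] at h0 ⊢
    cases b <;> cases c <;>
      simp only [List.count_cons, List.count_nil, if_true, Bool.false_eq_true, if_false] at h0 <;>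
      grind
  · simp only [List.isChain_append, List.isChain_cons] at h4' ⊢
    refine ⟨h4'.1.1, ⟨?_, ?_⟩, ?_⟩
    · rintro y hy ⟨_, rfl⟩
      exact hB hy
    · grind
    · intro y hy z _ ⟨hyN, _⟩
      exact hA (hyN ▸ hy)

theorem IsGood.notMem_of_split {N r : ℕ} (hN : r + 1 < N) {A B : List ℕ}
    (h : IsGood N r (A ++ N :: B)) : r + 1 ∉ A ∧ r + 1 ∉ B ∧ N ∉ A.getLast? ∧ N ∉ B.head? := by
  obtain ⟨_, h2, _, h4⟩ := h
  refine ⟨fun h => ?_, fun h => ?_, fun h => ?_, fun h => ?_⟩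
  · have := h2 (r + 1) (by simp [h]) (by omega)
    omega
  · have := h2 (r + 1) (by simp [h]) (by omega)
    omega
  · rw [List.isChain_append] at h4
    exact h4.2.2 N h N (by simp) ⟨rfl, rfl⟩
  · rw [List.isChain_append, List.isChain_cons] at h4
    exact h4.2.1.1 N h ⟨rfl, rfl⟩

/-- The value r + 1 occurs once, which fixes the cut. Since markers are isolated, A does not end and
B does not begin with one, so a marker beside r + 1 can only come from the pattern. -/
theorem append_pattern_inj {N r : ℕ} (hN : r + 1 < N) {A B A' B' : List ℕ} {s s' : Step}
    (h : IsGood N r (A ++ N :: B)) (h' : IsGood N r (A' ++ N :: B'))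
    (e : A ++ pattern N (r + 1) s ++ B = A' ++ pattern N (r + 1) s' ++ B') :
    A = A' ∧ B = B' ∧ s.1 = s'.1 ∧ s.2.1 = s'.2.1 := by
  obtain ⟨hA, hB, hA1, hB1⟩ := h.notMem_of_split hN
  obtain ⟨hA', hB', hA1', hB1'⟩ := h'.notMem_of_split hN
  obtain ⟨b, c, l⟩ := s
  obtain ⟨b', c', l'⟩ := s'
  have key := @List.append_cons_inj_of_notMem ℕ (A ++ if b then [N] else [])
    (A' ++ if b' then [N] else []) ((if c then [N] else []) ++ B)
    ((if c' then [N] else []) ++ B') (r + 1) (r + 1)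
    (by cases b <;> simp [hA]; omega) (by cases c <;> simp [hB]; omega)
  have e' := key.1 (by simpa [pattern] using e)
  obtain ⟨e1, -, e2⟩ := e'
  have h1 : A = A' ∧ b = b' := by
    cases b <;> cases b' <;> simp at e1 ⊢
    · exact e1
    · subst e1; simp at hA1
    · subst e1; simp at hA1'
    · exact e1
  have h2 : B = B' ∧ c = c' := by
    cases c <;> cases c' <;> simp at e2 ⊢
    · exact e2
    · subst e2; simp at hB1
    · subst e2; simp at hB1'
    · exact e2
  exact ⟨h1.1, h2.1, h1.2, h2.2⟩

theorem count_append_pattern {N x : ℕ} (hx : x ≠ N) (A B : List ℕ) (s : Step) :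
    (A ++ pattern N x s ++ B).count N =
      (A ++ N :: B).count N + s.1.toNat + s.2.1.toNat - 1 := by
  obtain ⟨b, c, l⟩ := s
  cases b <;> cases c <;> (simp [pattern, hx]; try omega)

theorem build_spec {N : ℕ} {h : List Step} (hv : Valid h) (hN : h.length < N) :
    IsGood N h.length (build N h) ∧ (build N h).count N = gaps h := by
  induction h with
  | nil => exact ⟨⟨by simp [build], by simp [build], by simp; omega, by simp [build]⟩,
      by simp [build, gaps]⟩
  | cons s h ih =>
    obtain ⟨h1, h2⟩ := hv
    rw [List.length_cons] at hN ⊢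
    obtain ⟨ih1, ih2⟩ := ih h1 (by omega)
    obtain ⟨A, B, hw, hA⟩ := exists_split_of_lt_count (ih2.symm ▸ h2)
    rw [build, hw, ← hA, replaceNth_append]
    rw [hw] at ih1 ih2
    exact ⟨ih1.insert hN s, by rw [count_append_pattern (by omega), ih2, gaps]⟩

theorem exists_build_cons {N : ℕ} {h : List Step} {s : Step} (hv : Valid (s :: h))
    (hN : (s :: h).length < N) :
    ∃ A B, build N h = A ++ N :: B ∧ A.count N = s.2.2 ∧
      build N (s :: h) = A ++ pattern N (h.length + 1) s ++ B := by
  obtain ⟨h1, h2⟩ := hv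
  rw [List.length_cons] at hN
  obtain ⟨A, B, hw, hA⟩ :=
    exists_split_of_lt_count ((build_spec (N := N) h1 (by omega)).2.symm ▸ h2)
  exact ⟨A, B, hw, hA, by rw [build, hw, ← hA, replaceNth_append]⟩

theorem build_injective {N : ℕ} {h h' : List Step} (hv : Valid h) (hv' : Valid h')
    (hl : h.length = h'.length) (hN : h.length < N) (e : build N h = build N h') : h = h' := by
  induction h generalizing h' with
  | nil => exact (List.length_eq_zero_iff.1 hl.symm).symm
  | cons s h ih =>
    cases h' with
    | nil => simp at hl
    | cons s' h' =>
      obtain ⟨A, B, h1, h2, h3⟩ := exists_build_cons hv hN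
      obtain ⟨A', B', h1', h2', h3'⟩ := exists_build_cons hv' (hl ▸ hN)
      simp only [List.length_cons, Nat.add_right_cancel_iff] at hl hN
      have g := (build_spec (N := N) hv.1 (by omega)).1
      have g' := (build_spec (N := N) hv'.1 (by omega)).1
      rw [h1] at g
      rw [h1', ← hl] at g'
      rw [h3, h3', ← hl] at e
      obtain ⟨rfl, rfl, e1, e2⟩ := append_pattern_inj hN g g' e
      rw [ih hv.1 hv'.1 hl (by omega) (h1.trans h1'.symm)]
      congr 1
      exact Prod.ext e1 (Prod.ext e2 (h2.symm.trans h2'))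

theorem IsGood.exists_build {N r : ℕ} (hN : r < N) {w : List ℕ} (h : IsGood N r w) :
    ∃ H, H.length = r ∧ Valid H ∧ build N H = w := by
  induction r generalizing w with
  | zero =>
    refine ⟨[], rfl, trivial, ?_⟩
    obtain ⟨h1, h2, _, h4⟩ := h
    have h5 : ∀ y ∈ w, y = N := fun y hy => by
      by_contra hne
      have := h2 y hy hne
      omega
    match w, h1 with
    | [a], _ => simp [build, h5 a (by simp)]
    | a :: b :: t, _ =>
      rw [List.isChain_cons] at h4
      exact absurd ⟨h5 a (by simp), h5 b (by simp)⟩ (h4.1 b (by simp))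
  | succ r ih =>
    obtain ⟨A, B, s, rfl, hg, hs⟩ := h.split hN
    obtain ⟨H, h1, h2, h3⟩ := ih (by omega) hg
    have h4 := (build_spec (N := N) h2 (by omega)).2
    refine ⟨s :: H, by simp [h1], ⟨h2, ?_⟩, ?_⟩
    · rw [← h4, h3, hs]
      simp
    · rw [build, h3, hs, replaceNth_append, h1]

/-! ### Neighbours and embracing numbers read off a history -/

/-- The number of adjacent pairs of letters in the relation `R`. -/
def adjCount (R : ℕ → ℕ → Prop) [DecidableRel R] : List ℕ → ℕ
  | [] => 0
  | [_] => 0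
  | a :: b :: t => (if R a b then 1 else 0) + adjCount R (b :: t)

/-- `a, b` is a descent passing over `x`. -/
abbrev DescOver (x a b : ℕ) : Prop := x < a ∧ b < x

/-- `a, b` is an ascent passing over `x`. -/
abbrev AscOver (x a b : ℕ) : Prop := x < b ∧ a < x

theorem adjCount_cons (R : ℕ → ℕ → Prop) [DecidableRel R] (a : ℕ) (t : List ℕ) :
    adjCount R (a :: t) = (if ∃ b, t.head? = some b ∧ R a b then 1 else 0) + adjCount R t := by
  cases t <;> simp [adjCount]

/-- The value `x` in the word `w` is placed as the step `s` says, and is followed by `e` ascents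
over `x`. -/
def HasData (w : List ℕ) (x : ℕ) (s : Step) (e : ℕ) : Prop :=
  ∃ A B, w = A ++ x :: B ∧ (x < A.getLastD 0 ↔ s.1 = true) ∧ (x < B.headD 0 ↔ s.2.1 = true) ∧
    adjCount (DescOver x) A = s.2.2 ∧ adjCount (AscOver x) B = e

/-- Seen from x, the new value j and the marker N are both simply larger than x, and a run of larger
letters has no internal passage over x. Later insertions therefore do not change the counts for x.
-/
theorem adjCount_append_pattern (R : ℕ → ℕ → Prop) [DecidableRel R] {N x j : ℕ} (hN : x < N)
    (hj : x < j) (hR : R = DescOver x ∨ R = AscOver x) (s : Step) (A B : List ℕ) :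
    adjCount R (A ++ pattern N j s ++ B) = adjCount R (A ++ N :: B) := by
  have e1 : (¬ j < x) ∧ (¬ N < x) := by omega
  have e2 : ∀ b, R j b ↔ R N b := by rcases hR with rfl | rfl <;> simp [*]
  have e3 : ∀ b, R b j ↔ R b N := by rcases hR with rfl | rfl <;> simp [*]
  have e4 : ¬ R N N := by rcases hR with rfl | rfl <;> simp [*]
  obtain ⟨b, c, l⟩ := s
  induction A with
  | nil => cases b <;> cases c <;> simp [pattern, adjCount_cons, e2, e3, e4]
  | cons a A ih =>
    simp only [List.cons_append, adjCount_cons R a, ih]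
    congr 2
    cases A <;> cases b <;> cases c <;> simp [pattern, e3]

theorem HasData.insert {N x j : ℕ} (hN : x < N) (hj : x < j) {A B : List ℕ} {s t : Step} {e : ℕ}
    (h : HasData (A ++ N :: B) x t e) : HasData (A ++ pattern N j s ++ B) x t e := by
  obtain ⟨P, Q, hw, h1, h2, h3, h4⟩ := h
  -- The filled gap lies either to the left of x or to the right of it.
  rcases List.append_eq_append_iff.1 hw with ⟨C, rfl, hC⟩ | ⟨C, rfl, hC⟩
  · cases C with
    | nil => simp at hC; omega
    | cons c C =>
      obtain ⟨rfl, rfl⟩ : N = c ∧ B = C ++ x :: Q := by simpa using hC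
      refine ⟨A ++ pattern N j s ++ C, Q, by simp, ?_, h2, ?_, h4⟩
      · rw [← h1]
        rcases C.eq_nil_or_concat' with rfl | ⟨C, a, rfl⟩
        · obtain ⟨b, c, l⟩ := s
          cases b <;> cases c <;> simp [pattern, hN, hj]
        · rw [show A ++ N :: (C ++ [a]) = (A ++ N :: C) ++ [a] by simp]
          simp [← List.append_assoc]
      · rw [adjCount_append_pattern _ hN hj (Or.inl rfl), h3]
  · cases C with
    | nil => simp at hC; omega
    | cons c C =>
      obtain ⟨rfl, rfl⟩ : x = c ∧ Q = C ++ N :: B := by simpa using hC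
      refine ⟨P, C ++ pattern N j s ++ B, by simp, h1, ?_, h3, ?_⟩
      · rw [← h2]
        obtain ⟨b, c, l⟩ := s
        cases C <;> cases b <;> cases c <;> simp [pattern, hN, hj]
      · rw [adjCount_append_pattern _ hN hj (Or.inr rfl), h4]

/-- Only markers exceed x, and each marker in A is followed there by a smaller letter, giving one
descent over x. The second count covers a marker kept just before x: nothing follows it in the
prefix, so it adds no descent. -/
theorem adjCount_descOver_top {N x : ℕ} (hx : x < N) (A : List ℕ)
    (h1 : ∀ y ∈ A, y = N ∨ y < x) (h2 : (A ++ [N]).IsChain fun a b => ¬(a = N ∧ b = N)) :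
    adjCount (DescOver x) A = A.count N ∧ adjCount (DescOver x) (A ++ [N]) = A.count N := by
  induction A with
  | nil => simp [adjCount]
  | cons a A ih =>
    rw [List.cons_append, List.isChain_cons] at h2
    obtain ⟨i1, i2⟩ := ih (fun y hy => h1 y (by simp [hy])) h2.2
    rw [List.cons_append, adjCount_cons, adjCount_cons, i1, i2]
    cases A with
    | nil =>
      have := h1 a (by simp)
      simp at h2
      simp [h2]
      omega
    | cons b A =>
      have := h1 a (by simp)
      have := h1 b (by simp)
      have h3 := h2.1 b (by simp)
      simp only [List.count_cons (a := N) (b := a), List.head?_cons, List.cons_append,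
        Option.some.injEq, exists_eq_left', beq_iff_eq]
      have h4 : DescOver x a b ↔ a = N := by constructor <;> omega
      simp only [h4]
      omega

theorem adjCount_ascOver_top {N x c : ℕ} (hx : x < N) (A : List ℕ) (hc : c = N ∨ c < x)
    (h1 : ∀ y ∈ A, y = N ∨ y < x) (h2 : (c :: A).IsChain fun a b => ¬(a = N ∧ b = N)) :
    adjCount (AscOver x) (c :: A) = A.count N := by
  induction A generalizing c with
  | nil => simp [adjCount]
  | cons a A ih =>
    have ha := h1 a (by simp)
    rw [List.isChain_cons] at h2
    have h3 := h2.1 a (by simp)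
    rw [adjCount_cons, ih ha (fun y hy => h1 y (by simp [hy])) h2.2]
    simp only [List.count_cons (a := N) (b := a), List.head?_cons, Option.some.injEq,
      exists_eq_left', beq_iff_eq]
    have h4 : AscOver x c a ↔ a = N := by constructor <;> omega
    simp only [h4]
    omega

/-- At the moment of its insertion x exceeds every value present, so passages over x correspond to
the other gaps. `HasData.insert` then carries this to the final word. -/
theorem hasData_insert_top {N x : ℕ} (hx : x < N) {A B : List ℕ}
    (h1 : ∀ y ∈ A ++ N :: B, y = N ∨ y < x)
    (h2 : (A ++ N :: B).IsChain fun a b => ¬(a = N ∧ b = N)) {s : Step} (hs : A.count N = s.2.2) :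
    HasData (A ++ pattern N x s ++ B) x s (B.count N) := by
  obtain ⟨b, c, l⟩ := s
  obtain rfl : _ = l := hs
  have hA : (A ++ [N]).IsChain fun a b => ¬(a = N ∧ b = N) := by
    rw [List.append_cons] at h2
    exact (List.isChain_append.1 h2).1
  have hB := (List.isChain_append.1 h2).2.1
  obtain ⟨a1, a2⟩ := adjCount_descOver_top hx A (fun y hy => h1 y (by simp [hy])) hA
  have b1 := adjCount_ascOver_top hx B (Or.inl rfl) (fun y hy => h1 y (by simp [hy])) hB
  -- `b1` serves the case where a marker is kept to the right of x. Without it, B still begins with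
  -- a smaller letter, so no marker in B loses its ascent.
  have b2 : adjCount (AscOver x) B = B.count N := by
    cases B with
    | nil => rfl
    | cons y B =>
      rw [List.isChain_cons] at hB
      have h3 := hB.1 y (by simp)
      rw [adjCount_ascOver_top hx B (h1 y (by simp)) (fun z hz => h1 z (by simp [hz])) hB.2,
        List.count_cons_of_ne (by omega)]
  refine ⟨A ++ (if b then [N] else []), (if c then [N] else []) ++ B, by simp [pattern], ?_, ?_,
    ?_, ?_⟩
  · cases b
    · rcases A.eq_nil_or_concat' with rfl | ⟨A, a, rfl⟩
      · simp
      · have := h1 a (by simp)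
        simp [List.isChain_append] at hA
        simp
        omega
    · simp [hx]
  · cases c
    · cases B with
      | nil => simp
      | cons y B =>
        have := h1 y (by simp)
        rw [List.isChain_cons] at hB
        have h3 := hB.1 y (by simp)
        simp
        omega
    · simp [hx]
  · cases b <;> simp [a1, a2]
  · cases c <;> simp [b1, b2]

/-- The step that inserted the value `x`. -/
def stepAt (h : List Step) (x : ℕ) : Step := h.getD (h.length - x) (false, false, 0)

/-- The number of gaps before the value `x` is inserted. -/
def gapsAt (h : List Step) (x : ℕ) : ℕ := gaps (h.drop (h.length - x + 1))

theorem stepAt_cons (s : Step) {h : List Step} {x : ℕ} (hx : x ≤ h.length) :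
    stepAt (s :: h) x = stepAt h x := by
  rw [stepAt, stepAt, List.length_cons, Nat.succ_sub hx, List.getD_cons_succ]

theorem stepAt_cons_self (s : Step) (h : List Step) : stepAt (s :: h) (h.length + 1) = s := by
  simp [stepAt]

theorem gapsAt_cons (s : Step) {h : List Step} {x : ℕ} (hx : x ≤ h.length) :
    gapsAt (s :: h) x = gapsAt h x := by
  rw [gapsAt, gapsAt, List.length_cons, Nat.succ_sub hx, List.drop_succ_cons]

theorem gapsAt_cons_self (s : Step) (h : List Step) :
    gapsAt (s :: h) (h.length + 1) = gaps h := by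
  simp [gapsAt]

theorem hasData_build {N : ℕ} {h : List Step} (hv : Valid h) (hN : h.length < N) {x : ℕ}
    (hx1 : 1 ≤ x) (hx2 : x ≤ h.length) :
    HasData (build N h) x (stepAt h x) (gapsAt h x - 1 - (stepAt h x).2.2) := by
  induction h with
  | nil => simp at hx2; omega
  | cons s h ih =>
    obtain ⟨A, B, h1, h2, h3⟩ := exists_build_cons hv hN
    rw [List.length_cons] at hN hx2
    rw [h3]
    rcases hx2.lt_or_eq with hx | rfl
    · rw [stepAt_cons s (by omega), gapsAt_cons s (by omega)]
      exact HasData.insert (by omega) (by omega) (h1 ▸ ih hv.1 (by omega) (by omega))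
    · rw [stepAt_cons_self, gapsAt_cons_self]
      obtain ⟨g1, g2⟩ := build_spec (N := N) hv.1 (by omega)
      have : B.count N = gaps h - 1 - s.2.2 := by
        rw [← g2, h1, ← h2]
        simp
      rw [← this]
      rw [h1] at g1
      refine hasData_insert_top hN (fun y hy => ?_) g1.chain h2
      have := g1.mem y hy
      omega

/-! ### Statistics and conditions on histories -/

/-- The sum of the gap indices of a history. -/
def lesSum : List Step → ℕ
  | [] => 0
  | s :: h => lesSum h + s.2.2

/-- The sum of the numbers of gaps to the right of the chosen ones. -/
def resSum : List Step → ℕ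
  | [] => 0
  | s :: h => resSum h + (gaps h - 1 - s.2.2)

/-- The histories of `F`-permutations. -/
def IsFHistory : List Step → Prop
  | [] => True
  | s :: h => IsFHistory h ∧
      if Even h.length then s.1 = true → s.2.1 = true else s.1 = false ∧ s.2.1 = true

/-- Every VOP pair of a history of even length has an even embracing number. -/
def IsNormalizedHistory : List Step → Prop
  | t :: s :: h => IsNormalizedHistory h ∧
      (s.1 = s.2.1 → Even (if Even (gaps h) then s.2.2 else t.2.2))
  | _ => True

/-- The number of VOP pairs of a history of even length. -/
def vopCount : List Step → ℕ
  | _ :: s :: h => vopCount h + if s.1 = s.2.1 then 1 else 0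
  | _ => 0

/-! ### Extracting a factor p + q from each VOP pair -/

section Sums

variable {R : Type*} [CommSemiring R]

/-- The terms l = 2i and l = 2i + 1 add up to p + q times a monomial. No subtraction or division is
used, so this works in a semiring. -/
theorem sum_range_two_mul_eq (p q : R) (t : ℕ) :
    ∑ l ∈ range (2 * t), p ^ (2 * t - 1 - l) * q ^ l =
      (p + q) * ∑ l ∈ range (2 * t), if Even l then p ^ (2 * t - 2 - l) * q ^ l else 0 := by
  have key : ∀ (f : ℕ → R) (t : ℕ), ∑ l ∈ range (2 * t), f l =
      ∑ i ∈ range t, (f (2 * i) + f (2 * i + 1)) := by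
    intro f t
    induction t with
    | zero => simp
    | succ t ih => rw [sum_range_succ, ← ih, Nat.mul_succ, sum_range_succ, sum_range_succ, add_assoc]
  rw [key, key, mul_sum]
  refine sum_congr rfl fun i hi => ?_
  rw [mem_range] at hi
  rw [if_pos (even_two_mul i), if_neg (by simp), show 2 * t - 1 - 2 * i = 2 * t - 2 - 2 * i + 1 by omega,
    show 2 * t - 1 - (2 * i + 1) = 2 * t - 2 - 2 * i by omega]
  ring

theorem sum_range_even_eq (p q : R) {a : ℕ} (ha : Even a) :
    ∑ l ∈ range a, p ^ (a - 1 - l) * q ^ l =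
      (p + q) * ∑ l ∈ range a, if Even l then p ^ (a - 2 - l) * q ^ l else 0 := by
  obtain ⟨t, rfl⟩ := ha
  rw [← two_mul]
  exact sum_range_two_mul_eq p q t

open Classical in
-- The effect of one pair: a and a' are the gap counts at its odd and its even value, while r and v
-- are the earlier values of `resSum` and `vopCount`. The bound `hv` makes the truncated exponents
-- exact.
theorem sum_pair_eq (p q : R) {a a' v r : ℕ} (hv : v ≤ r) (ha : 1 ≤ a) (b c : Bool)
    (ha' : a' = a + b.toNat + c.toNat - 1) :
    p ^ (r - v) * ∑ l ∈ range a, ∑ l' ∈ range a',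
        p ^ (a - 1 - l + (a' - 1 - l')) * q ^ (l + l') =
      (p + q) ^ (if b = c then 1 else 0) * ∑ l ∈ range a, ∑ l' ∈ range a',
        if (b = c → Even (if Even a then l else l')) then
          p ^ (r + (a - 1 - l) + (a' - 1 - l') - (v + if b = c then 1 else 0)) * q ^ (l + l')
        else 0 := by
  by_cases hbc : b = c
  · simp only [hbc, if_true, forall_const, pow_one]
    by_cases hae : Even a
    · simp only [hae, if_true]
      have h1 : ∑ l ∈ range a, ∑ l' ∈ range a',
          p ^ (a - 1 - l + (a' - 1 - l')) * q ^ (l + l') =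
          (∑ l ∈ range a, p ^ (a - 1 - l) * q ^ l) * ∑ l' ∈ range a', p ^ (a' - 1 - l') * q ^ l' := by
        rw [sum_mul_sum]
        exact sum_congr rfl fun l _ => sum_congr rfl fun l' _ => by ring
      rw [h1, sum_range_even_eq p q hae, mul_assoc, mul_left_comm, sum_mul_sum, mul_sum]
      congr 1
      refine sum_congr rfl fun l hl => ?_
      rw [mul_sum]
      refine sum_congr rfl fun l' hl' => ?_
      rw [mem_range] at hl hl'
      split_ifs with hle
      · have h2 : r + (a - 1 - l) + (a' - 1 - l') - (v + 1) =
            r - v + (a - 2 - l) + (a' - 1 - l') := by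
          -- An even l below an even a is at most a - 2, so a - 2 - l is not truncated.
          have : l ≠ a - 1 := by rintro rfl; grind
          omega
        rw [h2]
        ring
      · simp
    · simp only [hae, if_false]
      -- Here a is odd and b = c, so a' = a ± 1.
      have hae' : Even a' := by
        subst hbc
        cases b
        · simp at ha'; subst ha'; grind
        · simp at ha'; subst ha'; grind
      have h1 : ∑ l ∈ range a, ∑ l' ∈ range a',
          p ^ (a - 1 - l + (a' - 1 - l')) * q ^ (l + l') =
          (∑ l ∈ range a, p ^ (a - 1 - l) * q ^ l) * ∑ l' ∈ range a', p ^ (a' - 1 - l') * q ^ l' := by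
        rw [sum_mul_sum]
        exact sum_congr rfl fun l _ => sum_congr rfl fun l' _ => by ring
      rw [h1, sum_range_even_eq p q hae', mul_left_comm _ (p + q),
        mul_left_comm _ (p + q), sum_mul_sum, mul_sum]
      congr 1
      refine sum_congr rfl fun l hl => ?_
      rw [mul_sum]
      refine sum_congr rfl fun l' hl' => ?_
      rw [mem_range] at hl hl'
      split_ifs with hle
      · have h2 : r + (a - 1 - l) + (a' - 1 - l') - (v + 1) =
            r - v + (a - 1 - l) + (a' - 2 - l') := by
          have : l' ≠ a' - 1 := by rintro rfl; grind
          omega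
        rw [h2]
        ring
      · simp
  · simp only [hbc, if_false, pow_zero, one_mul, add_zero, mul_sum, false_imp_iff, if_true]
    refine sum_congr rfl fun l _ => sum_congr rfl fun l' _ => ?_
    have h2 : r + (a - 1 - l) + (a' - 1 - l') - v = r - v + (a - 1 - l + (a' - 1 - l')) := by omega
    rw [h2]
    ring

theorem vopCount_le_resSum {i : ℕ} {h : List Step} (hl : h.length = 2 * i) (hv : Valid h)
    (hn : IsNormalizedHistory h) : vopCount h ≤ resSum h := by
  induction i generalizing h with
  | zero =>
    obtain rfl := List.length_eq_zero_iff.1 hl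
    simp [vopCount]
  | succ i ih =>
    match h, hl with
    | t :: s :: h, hl =>
      obtain ⟨⟨h1, h2⟩, h3⟩ := hv
      obtain ⟨n1, n2⟩ := hn
      have := ih (h := h) (by simp at hl; omega) h1 n1
      simp only [vopCount, resSum, gaps] at h3 ⊢
      split_ifs with hs
      · have n3 := n2 hs
        obtain ⟨b, c, l⟩ := s
        obtain ⟨b', c', l'⟩ := t
        simp only at hs h2 h3 n3 ⊢
        subst hs
        cases b <;> simp at h3 ⊢ <;> grind
      · omega

/-- Steps are peeled off in pairs: the odd value may have any shape except a double descent, and the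
shape of the even value is forced. -/
theorem sum_fHistories_succ [DecidablePred IsFHistory] (i : ℕ) (F : List Step → R) :
    (∑ h ∈ histories (2 * (i + 1)), if IsFHistory h then F h else 0) =
      ∑ h ∈ histories (2 * i), if IsFHistory h then ∑ b : Bool, ∑ c : Bool,
        if b = true → c = true then ∑ l ∈ range (gaps h), ∑ l' ∈ range (gaps ((b, c, l) :: h)),
          F ((false, true, l') :: (b, c, l) :: h) else 0 else 0 := by
  rw [Nat.mul_succ, sum_histories_succ, sum_histories_succ]
  refine sum_congr rfl fun h hh => ?_
  have hev : Even h.length := (mem_histories.1 hh).1 ▸ even_two_mul i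
  by_cases hF : IsFHistory h
  swap
  · simp [IsFHistory, hF]
  rw [if_pos hF]
  refine sum_congr rfl fun b _ => sum_congr rfl fun c _ => ?_
  by_cases hbc : b = true → c = true
  · simp [IsFHistory, hF, hev, Nat.even_add_one]
  · simp only [IsFHistory, hF, hev, if_true, hbc, and_false, false_and, if_false, sum_const_zero]

/-- Factoring a sum over `F`-histories of even length through the normalized ones. -/
theorem sum_fHistories_eq [DecidablePred IsFHistory] [DecidablePred IsNormalizedHistory] (p q : R)
    (i : ℕ) (g : ℕ → ℕ → R) :
    (∑ h ∈ histories (2 * i), if IsFHistory h then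
        p ^ resSum h * q ^ lesSum h * g (gaps h) (vopCount h) else 0) =
      ∑ h ∈ histories (2 * i), if IsFHistory h then if IsNormalizedHistory h then
        (p + q) ^ vopCount h * (p ^ (resSum h - vopCount h) * q ^ lesSum h) *
          g (gaps h) (vopCount h) else 0 else 0 := by
  classical
  -- The arbitrary weight g lets the last pair be absorbed into a new weight that depends only on
  -- the gaps and VOP pairs before it.
  induction i generalizing g with
  | zero => simp [histories, vopCount, resSum, IsFHistory, IsNormalizedHistory]
  | succ i ih =>
    rw [sum_fHistories_succ, sum_fHistories_succ]
    let G : ℕ → ℕ → R := fun a v => ∑ b : Bool, ∑ c : Bool, if (b = true → c = true) then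
      (∑ l ∈ range a, ∑ l' ∈ range (a + b.toNat + c.toNat - 1),
        p ^ (a - 1 - l + (a + b.toNat + c.toNat - 1 - 1 - l')) * q ^ (l + l')) *
          g (a + b.toNat + c.toNat - 1) (v + if b = c then 1 else 0) else 0
    trans ∑ h ∈ histories (2 * i), if IsFHistory h then
        p ^ resSum h * q ^ lesSum h * G (gaps h) (vopCount h) else 0
    · refine sum_congr rfl fun h _ => ?_
      split_ifs
      swap
      · rfl
      simp only [G]
      rw [mul_sum]
      refine sum_congr rfl fun b _ => ?_
      rw [mul_sum]
      refine sum_congr rfl fun c _ => ?_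
      by_cases hbc : b = true → c = true
      swap
      · simp only [hbc, if_false, mul_zero]
      rw [if_pos hbc, if_pos hbc]
      rw [sum_mul, mul_sum]
      refine sum_congr rfl fun l _ => ?_
      rw [sum_mul, mul_sum]
      refine sum_congr rfl fun l' _ => ?_
      simp only [resSum, lesSum, gaps, vopCount, Bool.toNat_false, Bool.toNat_true, add_zero,
        Nat.add_sub_cancel]
      ring
    rw [ih G]
    refine sum_congr rfl fun h hh => ?_
    obtain ⟨hl, hv⟩ := mem_histories.1 hh
    split_ifs with hF hn
    · simp only [G]
      rw [mul_sum]
      refine sum_congr rfl fun b _ => ?_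
      rw [mul_sum]
      refine sum_congr rfl fun c _ => ?_
      by_cases hbc : b = true → c = true
      swap
      · simp only [hbc, if_false, mul_zero]
      rw [if_pos hbc, if_pos hbc]
      -- With no gap available both sums over l are empty; otherwise `sum_pair_eq` applies.
      by_cases h0 : gaps h = 0
      · simp [h0]
      have key := sum_pair_eq p q (vopCount_le_resSum hl hv hn) (a := gaps h) (by omega) b c rfl
      trans (p + q) ^ vopCount h * q ^ lesSum h *
        g (gaps h + b.toNat + c.toNat - 1) (vopCount h + if b = c then 1 else 0) *
        (p ^ (resSum h - vopCount h) * ∑ l ∈ range (gaps h),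
          ∑ l' ∈ range (gaps h + b.toNat + c.toNat - 1),
            p ^ (gaps h - 1 - l + (gaps h + b.toNat + c.toNat - 1 - 1 - l')) * q ^ (l + l'))
      · ring
      rw [key, ← mul_assoc, mul_sum]
      refine sum_congr rfl fun l _ => ?_
      rw [mul_sum]
      refine sum_congr rfl fun l' _ => ?_
      simp only [IsNormalizedHistory, hn, true_and, resSum, lesSum, gaps, vopCount,
        Bool.toNat_false, Bool.toNat_true, add_zero, Nat.add_sub_cancel]
      by_cases hN : b = c → Even (if Even (gaps h) then l else l')
      · rw [if_pos hN, if_pos hN]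
        ring
      · rw [if_neg hN, if_neg hN, mul_zero]
    · symm
      simp [IsNormalizedHistory, hn]
    · rfl

end Sums

/-! ### Permutations as words without gap markers -/

/-- The word of a permutation as a list. -/
def word {m : ℕ} (σ : Equiv.Perm (Fin m)) : List ℕ := List.ofFn fun i => (σ i : ℕ) + 1

section Word

variable {m : ℕ} (σ : Equiv.Perm (Fin m))

@[simp] theorem length_word : (word σ).length = m := by simp [word]

theorem entry_zero : entry σ 0 = 0 := by simp [entry]

theorem entry_succ (i : ℕ) : entry σ (i + 1) = (word σ).getD i 0 := by
  by_cases h : i < m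
  · simp [entry, word, List.getD, h, show i + 1 ≤ m from h]
  · simp [entry, word, List.getD, h, show ¬ i + 1 ≤ m from h]

theorem mem_word {x : ℕ} : x ∈ word σ ↔ 1 ≤ x ∧ x ≤ m := by
  rw [word, List.mem_ofFn]
  constructor
  · rintro ⟨i, rfl⟩
    have := (σ i).2
    omega
  · rintro ⟨h1, h2⟩
    exact ⟨σ.symm ⟨x - 1, by omega⟩, by simp; omega⟩

theorem nodup_word : (word σ).Nodup := by
  rw [word, List.nodup_ofFn]
  intro i j hij
  exact σ.injective (Fin.ext (by simpa using hij))

theorem word_injective : Function.Injective (word (m := m)) := by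
  intro σ τ h
  have := List.ofFn_injective h
  ext i
  simpa using congrFun this i

theorem isGood_word {N : ℕ} (hm : 0 < m) (hN : m < N) : IsGood N m (word σ) := by
  refine ⟨?_, ?_, ?_, ?_⟩
  · rw [← List.length_pos_iff, length_word]
    exact hm
  · exact fun y hy _ => (mem_word σ).1 hy
  · exact fun y h1 h2 => List.count_eq_one_of_mem (nodup_word σ) ((mem_word σ).2 ⟨h1, h2⟩)
  · exact (List.pairwise_of_forall_mem_list fun a ha b _ hab => by
      have := (mem_word σ).1 ha
      omega).isChain

/-- `h` is the history of `σ`. -/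
structure IsHistoryOf (h : List Step) : Prop where
  length : h.length = m
  valid : Valid h
  build : build (m + 1) h = word σ

theorem exists_isHistoryOf (hm : 0 < m) : ∃ h, IsHistoryOf σ h := by
  obtain ⟨h, h1, h2, h3⟩ := (isGood_word σ hm (Nat.lt_succ_self m)).exists_build (Nat.lt_succ_self m)
  exact ⟨h, h1, h2, h3⟩

theorem IsHistoryOf.gaps_eq_zero {σ : Equiv.Perm (Fin m)} {h : List Step} (H : IsHistoryOf σ h) :
    gaps h = 0 := by
  rw [← (build_spec (N := m + 1) H.valid (by rw [H.length]; omega)).2, H.build,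
    List.count_eq_zero, mem_word]
  omega

theorem exists_perm_of_history {h : List Step} (h1 : h.length = m) (h2 : Valid h)
    (h3 : gaps h = 0) : ∃ σ : Equiv.Perm (Fin m), IsHistoryOf σ h := by
  obtain ⟨g, hc⟩ := build_spec (N := m + 1) h2 (by omega)
  rw [h3, List.count_eq_zero] at hc
  rw [h1] at g
  set w := build (m + 1) h with hw
  have hmem : ∀ y, y ∈ w ↔ 1 ≤ y ∧ y ≤ m := fun y =>
    ⟨fun hy => g.mem y hy (by rintro rfl; exact hc hy),
      fun hy => List.count_pos_iff.1 (by rw [g.count y hy.1 hy.2]; exact one_pos)⟩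
  have hnd : w.Nodup := List.nodup_iff_count_le_one.2 fun y => by
    by_cases hy : y ∈ w
    · exact (g.count y ((hmem y).1 hy).1 ((hmem y).1 hy).2).le
    · rw [List.count_eq_zero.2 hy]
      exact zero_le_one
  have hlen : w.length = m := by
    rw [← List.toFinset_card_of_nodup hnd, show w.toFinset = Icc 1 m by ext y; simp [hmem]]
    simp
  let f : Fin m → Fin m := fun i => ⟨w[i.1]'(by omega) - 1, by
    have := (hmem (w[i.1]'(by omega))).1 (List.getElem_mem _)
    omega⟩
  have hf : Function.Injective f := fun i j hij => by
    have e1 := (hmem (w[i.1]'(by omega))).1 (List.getElem_mem _)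
    have e2 := (hmem (w[j.1]'(by omega))).1 (List.getElem_mem _)
    have e3 : w[i.1]'(by omega) - 1 = w[j.1]'(by omega) - 1 := congrArg Fin.val hij
    exact Fin.ext ((hnd.getElem_inj_iff (hi := by omega) (hj := by omega)).1 (by omega))
  refine ⟨Equiv.ofBijective f (Finite.injective_iff_bijective.1 hf), h1, h2, ?_⟩
  refine List.ext_getElem (by simp [hlen, ← hw]) fun i hi hi' => ?_
  have e1 := (hmem _).1 (List.getElem_mem hi)
  have e2 : (build (m + 1) h)[i] - 1 + 1 = (build (m + 1) h)[i] := Nat.sub_add_cancel e1.1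
  simpa [word, f, hw] using e2.symm

theorem adjCount_eq_card (R : ℕ → ℕ → Prop) [DecidableRel R] (A : List ℕ) :
    adjCount R A =
      ((range (A.length - 1)).filter fun t => R (A.getD t 0) (A.getD (t + 1) 0)).card := by
  rw [card_filter]
  induction A with
  | nil => simp [adjCount]
  | cons a A ih =>
    cases A with
    | nil => simp [adjCount]
    | cons b A =>
      rw [adjCount, ih]
      simp only [List.length_cons, Nat.add_sub_cancel]
      rw [sum_range_succ', add_comm]
      simp

theorem entry_mem {i : ℕ} (h1 : 1 ≤ i) (h2 : i ≤ m) : 1 ≤ entry σ i ∧ entry σ i ≤ m := by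
  rw [entry, dif_pos ⟨h1, h2⟩]
  have := (σ ⟨i - 1, by omega⟩).2
  omega

theorem entry_inj {i j : ℕ} (hi : 1 ≤ i) (hi' : i ≤ m) (h : entry σ i = entry σ j) : i = j := by
  have h1 := entry_mem σ hi hi'
  by_cases hj : 1 ≤ j ∧ j ≤ m
  · rw [entry, entry, dif_pos ⟨hi, hi'⟩, dif_pos hj] at h
    have := σ.injective (Fin.ext (Nat.add_right_cancel h))
    simp only [Fin.mk.injEq] at this
    omega
  · rw [h, entry, dif_neg hj] at h1
    omega

/-- The number of pairs `(i, j)` counted by `res` with `σ_i = x`. -/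
def rightEmbracings (x : ℕ) : ℕ :=
  (((Ico 1 m ×ˢ Ico 1 m).filter fun z =>
    z.1 < z.2 ∧ entry σ (z.2 + 1) > entry σ z.1 ∧ entry σ z.1 > entry σ z.2).filter
      fun z => entry σ z.1 = x).card

theorem les_eq_sum : les σ = ∑ x ∈ Icc 1 m, leftEmbracings σ x := by
  refine card_eq_sum_card_fiberwise fun z hz => ?_
  simp only [lesPairs, coe_filter, mem_product, mem_Icc, Set.mem_ofPred_eq] at hz
  simpa using entry_mem σ (by omega) hz.1.2.2

theorem res_eq_sum : res σ = ∑ x ∈ Icc 1 m, rightEmbracings σ x := by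
  refine card_eq_sum_card_fiberwise fun z hz => ?_
  simp only [coe_filter, mem_product, mem_Ico, Set.mem_ofPred_eq] at hz
  simpa using entry_mem σ (by omega) hz.1.1.2.le

theorem position_data {A B : List ℕ} {x : ℕ} (hw : word σ = A ++ x :: B) :
    entry σ (A.length + 1) = x ∧ entry σ A.length = A.getLastD 0 ∧
    entry σ (A.length + 2) = B.headD 0 ∧
    leftEmbracings σ x = adjCount (DescOver x) A ∧
    rightEmbracings σ x = adjCount (AscOver x) B := by
  have hlen : A.length + 1 + B.length = m := by
    rw [← length_word σ, hw]
    simp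
    omega
  have hx : entry σ (A.length + 1) = x := by rw [entry_succ, hw]; simp
  have hA : ∀ t < A.length, entry σ (t + 1) = A.getD t 0 := fun t ht => by
    rw [entry_succ, hw, List.getD_append _ _ _ _ ht]
  have hB : ∀ t, entry σ (A.length + 2 + t) = B.getD t 0 := fun t => by
    rw [show A.length + 2 + t = A.length + 1 + t + 1 by omega, entry_succ, hw,
      List.getD_append_right _ _ _ _ (by omega), show A.length + 1 + t - A.length = t + 1 by omega,
      List.getD_cons_succ]
  have hpos : ∀ {i}, entry σ i = x → i = A.length + 1 := fun {i} hi =>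
    (entry_inj σ (by omega) (by omega) (hx.trans hi.symm)).symm
  refine ⟨hx, ?_, ?_, ?_, ?_⟩
  · rcases A.eq_nil_or_concat' with rfl | ⟨A, a, rfl⟩
    · simp [entry_zero]
    · rw [List.length_append, List.length_singleton, hA _ (by simp)]
      simp
  · rw [← Nat.add_zero (A.length + 2), hB]
    cases B <;> simp
  -- Index t of A is position t + 1 of the word, so the descent at t, t + 1 has its bottom at i = t
  -- + 2.
  · rw [adjCount_eq_card, ← card_image_of_injective (f := fun t => (t + 2, A.length + 1)) _
      (fun a b hab => by simpa using hab), leftEmbracings]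
    congr 1
    ext ⟨u, v⟩
    simp only [lesPairs, mem_filter, mem_product, mem_Icc, mem_image, mem_range, Prod.mk.injEq]
    constructor
    · rintro ⟨⟨⟨⟨h1, h2⟩, h3, h4⟩, h5, h6, h7⟩, h8⟩
      obtain rfl := hpos h8
      refine ⟨u - 2, ⟨by omega, ?_⟩, by omega, rfl⟩
      rw [← hA _ (by omega), ← hA _ (by omega), show u - 2 + 1 = u - 1 by omega,
        show u - 1 + 1 = u by omega]
      omega
    · rintro ⟨t, ⟨h1, h2⟩, rfl, rfl⟩
      rw [← hA _ (by omega), ← hA _ (by omega)] at h2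
      rw [hx, show t + 2 - 1 = t + 1 by omega]
      have h2' : x < entry σ (t + 1) ∧ entry σ (t + 2) < x := h2
      omega
  · rw [adjCount_eq_card, ← card_image_of_injective
      (f := fun t => (A.length + 1, A.length + 2 + t)) _
      (fun a b hab => by simpa using hab), rightEmbracings]
    congr 1
    ext ⟨u, v⟩
    simp only [mem_filter, mem_product, mem_Ico, mem_image, mem_range, Prod.mk.injEq]
    constructor
    · rintro ⟨⟨⟨⟨h1, h2⟩, h3, h4⟩, h5, h6, h7⟩, h8⟩
      obtain rfl := hpos h8
      refine ⟨v - (A.length + 2), ⟨by omega, ?_⟩, rfl, by omega⟩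
      rw [← hB, ← hB, show A.length + 2 + (v - (A.length + 2)) = v by omega,
        show A.length + 2 + (v - (A.length + 2) + 1) = v + 1 by omega]
      omega
    · rintro ⟨t, ⟨h1, h2⟩, rfl, rfl⟩
      rw [← hB, ← hB, ← Nat.add_assoc] at h2
      rw [hx]
      omega

end Word

/-! ### Statistics of a permutation in terms of its history -/

section History

variable {m : ℕ} {σ : Equiv.Perm (Fin m)} {h : List Step}

theorem IsHistoryOf.data (H : IsHistoryOf σ h) {i : ℕ} (hi : 1 ≤ i) (hi' : i ≤ m) :
    (entry σ i < entry σ (i - 1) ↔ (stepAt h (entry σ i)).1 = true) ∧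
    (entry σ i < entry σ (i + 1) ↔ (stepAt h (entry σ i)).2.1 = true) ∧
    (entry σ (i - 1) < entry σ i ↔ (stepAt h (entry σ i)).1 = false) ∧
    (entry σ (i + 1) < entry σ i ↔ (stepAt h (entry σ i)).2.1 = false) := by
  obtain ⟨e1, e2⟩ := entry_mem σ hi hi'
  obtain ⟨A, B, h1, h2, h3, -, -⟩ := hasData_build (N := m + 1) H.valid
    (by rw [H.length]; omega) e1 (H.length.symm ▸ e2)
  rw [H.build] at h1
  obtain ⟨d1, d2, d3, -, -⟩ := position_data σ h1
  have hpos := entry_inj σ hi hi' d1.symm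
  have n1 : entry σ i ≠ entry σ (i - 1) := fun h => by
    have := entry_inj σ hi hi' h
    omega
  have n2 : entry σ i ≠ entry σ (i + 1) := fun h => by
    have := entry_inj σ hi hi' h
    omega
  rw [← d2, show A.length = i - 1 by omega] at h2
  rw [← d3, show A.length + 2 = i + 1 by omega] at h3
  refine ⟨h2, h3, ?_, ?_⟩
  · rw [← Bool.not_eq_true, ← h2]
    omega
  · rw [← Bool.not_eq_true, ← h3]
    omega

theorem IsHistoryOf.embracings (H : IsHistoryOf σ h) {x : ℕ} (hx : 1 ≤ x) (hx' : x ≤ m) :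
    leftEmbracings σ x = (stepAt h x).2.2 ∧
    rightEmbracings σ x = gapsAt h x - 1 - (stepAt h x).2.2 := by
  obtain ⟨A, B, h1, h2, h3, h4, h5⟩ := hasData_build (N := m + 1) H.valid
    (by rw [H.length]; omega) hx (H.length.symm ▸ hx')
  rw [H.build] at h1
  obtain ⟨d1, d2, d3, d4, d5⟩ := position_data σ h1
  exact ⟨d4.trans h4, d5.trans h5⟩

theorem exists_entry_eq (σ : Equiv.Perm (Fin m)) {x : ℕ} (hx : 1 ≤ x) (hx' : x ≤ m) :
    ∃ i, 1 ≤ i ∧ i ≤ m ∧ entry σ i = x := by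
  obtain ⟨A, B, hw⟩ := List.append_of_mem ((mem_word σ).2 ⟨hx, hx'⟩)
  refine ⟨A.length + 1, by omega, ?_, (position_data σ hw).1⟩
  rw [← length_word σ, hw]
  simp

theorem IsHistoryOf.mem_valleys (H : IsHistoryOf σ h) {x : ℕ} : x ∈ valleys σ ↔
    (1 ≤ x ∧ x ≤ m) ∧ (stepAt h x).1 = true ∧ (stepAt h x).2.1 = true := by
  simp only [valleys, mem_image, mem_filter, mem_Icc]
  constructor
  · rintro ⟨i, ⟨hi, h1, h2⟩, rfl⟩
    have d := H.data hi.1 hi.2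
    exact ⟨entry_mem σ hi.1 hi.2, d.1.1 h1, d.2.1.1 h2⟩
  · rintro ⟨hx, h1, h2⟩
    obtain ⟨i, hi, hi', rfl⟩ := exists_entry_eq σ hx.1 hx.2
    have d := H.data hi hi'
    exact ⟨i, ⟨⟨hi, hi'⟩, d.1.2 h1, d.2.1.2 h2⟩, rfl⟩

theorem IsHistoryOf.mem_peaks (H : IsHistoryOf σ h) {x : ℕ} : x ∈ peaks σ ↔
    (1 ≤ x ∧ x ≤ m) ∧ (stepAt h x).1 = false ∧ (stepAt h x).2.1 = false := by
  simp only [peaks, mem_image, mem_filter, mem_Icc]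
  constructor
  · rintro ⟨i, ⟨hi, h1, h2⟩, rfl⟩
    have d := H.data hi.1 hi.2
    exact ⟨entry_mem σ hi.1 hi.2, d.2.2.1.1 h1, d.2.2.2.1 h2⟩
  · rintro ⟨hx, h1, h2⟩
    obtain ⟨i, hi, hi', rfl⟩ := exists_entry_eq σ hx.1 hx.2
    have d := H.data hi hi'
    exact ⟨i, ⟨⟨hi, hi'⟩, d.2.2.1.2 h1, d.2.2.2.2 h2⟩, rfl⟩

theorem IsHistoryOf.mem_doubleDescents (H : IsHistoryOf σ h) {x : ℕ} : x ∈ doubleDescents σ ↔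
    (1 ≤ x ∧ x ≤ m) ∧ (stepAt h x).1 = true ∧ (stepAt h x).2.1 = false := by
  simp only [doubleDescents, mem_image, mem_filter, mem_Icc]
  constructor
  · rintro ⟨i, ⟨hi, h1, h2⟩, rfl⟩
    have d := H.data hi.1 hi.2
    exact ⟨entry_mem σ hi.1 hi.2, d.1.1 h1, d.2.2.2.1 h2⟩
  · rintro ⟨hx, h1, h2⟩
    obtain ⟨i, hi, hi', rfl⟩ := exists_entry_eq σ hx.1 hx.2
    have d := H.data hi hi'
    exact ⟨i, ⟨⟨hi, hi'⟩, d.1.2 h1, d.2.2.2.2 h2⟩, rfl⟩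

/-- Descents are counted by their bottoms, the values with a larger left neighbour. -/
theorem IsHistoryOf.des_eq (H : IsHistoryOf σ h) :
    des σ = ((Icc 1 m).filter fun x => (stepAt h x).1 = true).card := by
  rw [des]
  refine card_bij (fun i _ => entry σ (i + 1)) ?_ ?_ ?_
  · intro i hi
    simp only [descents, mem_filter, mem_Ico, mem_Icc] at hi ⊢
    exact ⟨entry_mem σ (by omega) (by omega), (H.data (by omega) (by omega)).1.1 hi.2⟩
  · intro i hi j hj hij
    simp only [descents, mem_filter, mem_Ico] at hi hj
    have := entry_inj σ (by omega) (by omega) hij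
    omega
  · intro x hx
    simp only [mem_filter, mem_Icc] at hx
    obtain ⟨i, hi, hi', rfl⟩ := exists_entry_eq σ hx.1.1 hx.1.2
    have d := (H.data hi hi').1.2 hx.2
    have hi1 : i ≠ 1 := by
      rintro rfl
      simp [entry_zero] at d
    have e : i - 1 + 1 = i := by omega
    refine ⟨i - 1, ?_, by rw [e]⟩
    simp only [descents, mem_filter, mem_Ico, e]
    exact ⟨by omega, d⟩

theorem lesSum_eq (h : List Step) : lesSum h = ∑ x ∈ Icc 1 h.length, (stepAt h x).2.2 := by
  induction h with
  | nil => simp [lesSum]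
  | cons s h ih =>
    rw [lesSum, List.length_cons, sum_Icc_succ_top (by omega), stepAt_cons_self, ih]
    congr 1
    exact sum_congr rfl fun x hx => by rw [stepAt_cons s (mem_Icc.1 hx).2]

theorem resSum_eq (h : List Step) :
    resSum h = ∑ x ∈ Icc 1 h.length, (gapsAt h x - 1 - (stepAt h x).2.2) := by
  induction h with
  | nil => simp [resSum]
  | cons s h ih =>
    rw [resSum, List.length_cons, sum_Icc_succ_top (by omega), stepAt_cons_self, gapsAt_cons_self,
      ih]
    congr 1
    exact sum_congr rfl fun x hx => by
      rw [stepAt_cons s (mem_Icc.1 hx).2, gapsAt_cons s (mem_Icc.1 hx).2]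

theorem IsHistoryOf.les_eq (H : IsHistoryOf σ h) : les σ = lesSum h := by
  rw [les_eq_sum, lesSum_eq, H.length]
  exact sum_congr rfl fun x hx => (H.embracings (mem_Icc.1 hx).1 (mem_Icc.1 hx).2).1

theorem IsHistoryOf.res_eq (H : IsHistoryOf σ h) : res σ = resSum h := by
  rw [res_eq_sum, resSum_eq, H.length]
  exact sum_congr rfl fun x hx => (H.embracings (mem_Icc.1 hx).1 (mem_Icc.1 hx).2).2

theorem gapsAt_one (hl : 0 < h.length) : gapsAt h 1 = 1 := by
  rw [gapsAt, Nat.sub_add_cancel hl, List.drop_length, gaps]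

theorem stepAt_lt_gapsAt (hv : Valid h) {x : ℕ} (hx : 1 ≤ x) (hx' : x ≤ h.length) :
    (stepAt h x).2.2 < gapsAt h x := by
  induction h with
  | nil => simp at hx'; omega
  | cons s h ih =>
    rw [List.length_cons] at hx'
    rcases hx'.lt_or_eq with hx' | rfl
    · rw [stepAt_cons s (by omega), gapsAt_cons s (by omega)]
      exact ih hv.1 (by omega)
    · rw [stepAt_cons_self, gapsAt_cons_self]
      exact hv.2

theorem gapsAt_succ {x : ℕ} (hx : 1 ≤ x) (hx' : x < h.length) :
    gapsAt h (x + 1) = gapsAt h x + (stepAt h x).1.toNat + (stepAt h x).2.1.toNat - 1 := by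
  induction h with
  | nil => simp at hx'
  | cons s h ih =>
    rw [List.length_cons] at hx'
    rw [stepAt_cons s (by omega), gapsAt_cons (x := x) s (by omega)]
    rcases (Nat.le_of_lt_succ hx').lt_or_eq with hx' | rfl
    · rw [gapsAt_cons s (by omega)]
      exact ih hx'
    · rw [gapsAt_cons_self]
      cases h with
      | nil => simp at hx
      | cons t h => rw [List.length_cons, stepAt_cons_self, gapsAt_cons_self, gaps]

/-- A valley opens one gap, a peak closes one, and the other shapes preserve the number. The initial
gap accounts for the + 1 in the height. -/
theorem IsHistoryOf.height_eq (H : IsHistoryOf σ h) {x : ℕ} (hx : 1 ≤ x) (hx' : x ≤ m) :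
    height σ x = gapsAt h x := by
  induction x, hx using Nat.le_induction with
  | base =>
    rw [gapsAt_one (by rw [H.length]; omega)]
    have h1 : (valleys σ).filter (· < 1) = ∅ := filter_eq_empty_iff.2 fun y hy => by
      have := (H.mem_valleys.1 hy).1
      omega
    have h2 : (peaks σ).filter (· < 1) = ∅ := filter_eq_empty_iff.2 fun y hy => by
      have := (H.mem_peaks.1 hy).1
      omega
    rw [height, h1, h2]
    simp
  | succ x hx ih =>
    have ih := ih (by omega)
    have key : ∀ S : Finset ℕ, ((S.filter (· < x + 1)).card : ℤ) =
        (S.filter (· < x)).card + if x ∈ S then 1 else 0 := by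
      intro S
      have h1 : S.filter (· < x + 1) = S.filter (· < x) ∪ S.filter (· = x) := by
        ext y
        simp only [mem_filter, mem_union]
        grind
      rw [h1, card_union_of_disjoint, filter_eq']
      · split_ifs <;> simp
      · rw [Finset.disjoint_left]
        intro y hy hy'
        simp only [mem_filter] at hy hy'
        omega
    rw [height] at ih ⊢
    rw [key, key, gapsAt_succ hx (by rw [H.length]; omega)]
    have h3 := stepAt_lt_gapsAt H.valid hx (by rw [H.length]; omega)
    simp only [H.mem_valleys, H.mem_peaks]
    rcases hs : stepAt h x with ⟨b, c, l⟩
    cases b <;> cases c <;> simp [hx, show x ≤ m by omega] <;> omega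

end History

/-! ### F-permutations and normalization in terms of histories -/

theorem isFHistory_iff {h : List Step} : IsFHistory h ↔ ∀ x ∈ Icc 1 h.length,
    if Odd x then (stepAt h x).1 = true → (stepAt h x).2.1 = true
    else (stepAt h x).1 = false ∧ (stepAt h x).2.1 = true := by
  induction h with
  | nil => simp [IsFHistory]
  | cons s h ih =>
    rw [IsFHistory, ih, List.length_cons, ← insert_Icc_right_eq_Icc_add_one (by omega),
      forall_mem_insert, stepAt_cons_self, and_comm]
    refine and_congr ?_ (forall₂_congr fun x hx => ?_)
    · simp only [Nat.odd_add_one, Nat.not_odd_iff_even]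
    · rw [stepAt_cons s (mem_Icc.1 hx).2]

theorem isNormalizedHistory_iff {n : ℕ} {h : List Step} (hl : h.length = 2 * n) :
    IsNormalizedHistory h ↔ ∀ i ∈ Icc 1 n,
      (stepAt h (2 * i - 1)).1 = (stepAt h (2 * i - 1)).2.1 →
      Even (if Even (gapsAt h (2 * i - 1)) then (stepAt h (2 * i - 1)).2.2
        else (stepAt h (2 * i)).2.2) := by
  induction n generalizing h with
  | zero =>
    obtain rfl := List.length_eq_zero_iff.1 hl
    simp [IsNormalizedHistory]
  | succ n ih =>
    match h, hl with
    | t :: s :: h, hl =>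
      have hl : h.length = 2 * n := by simp at hl; omega
      rw [IsNormalizedHistory, ih hl, ← insert_Icc_right_eq_Icc_add_one (by omega),
        forall_mem_insert, and_comm]
      have e1 : 2 * (n + 1) - 1 = h.length + 1 := by omega
      have e2 : 2 * (n + 1) = (s :: h).length + 1 := by rw [List.length_cons]; omega
      refine and_congr ?_ (forall₂_congr fun i hi => ?_)
      · rw [e1, stepAt_cons t (by simp), stepAt_cons_self, gapsAt_cons t (by simp),
          gapsAt_cons_self, e2, stepAt_cons_self]
      · rw [mem_Icc] at hi
        have := List.length_cons (a := s) (as := h)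
        rw [stepAt_cons t (by omega), stepAt_cons s (by omega), gapsAt_cons t (by omega),
          gapsAt_cons s (by omega), stepAt_cons t (by omega), stepAt_cons s (by omega)]

/-- The number of steps whose value has a larger left neighbour. -/
def descentCount (h : List Step) : ℕ := ((Icc 1 h.length).filter fun x => (stepAt h x).1 = true).card

theorem descentCount_cons (s : Step) (h : List Step) :
    descentCount (s :: h) = descentCount h + s.1.toNat := by
  rw [descentCount, descentCount, card_filter, card_filter, List.length_cons,
    sum_Icc_succ_top (by omega), stepAt_cons_self]
  congr 1
  · exact sum_congr rfl fun x hx => by rw [stepAt_cons s (mem_Icc.1 hx).2]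
  · cases s.1 <;> simp

/-- In each pair a valley adds one descent bottom, one VOP pair and one gap; a peak adds a VOP pair
and removes a gap; a double ascent changes nothing. -/
theorem two_mul_descentCount_add_one {n : ℕ} {h : List Step} (hl : h.length = 2 * n)
    (hv : Valid h) (hF : IsFHistory h) : 2 * descentCount h + 1 = vopCount h + gaps h := by
  induction n generalizing h with
  | zero =>
    obtain rfl := List.length_eq_zero_iff.1 hl
    simp [descentCount, vopCount, gaps]
  | succ n ih =>
    match h, hl with
    | t :: s :: h, hl =>
      have hl : h.length = 2 * n := by simp at hl; omega
      obtain ⟨⟨h1, h2⟩, h3⟩ := hv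
      obtain ⟨⟨f1, f2⟩, f3⟩ := hF
      have := ih hl h1 f1
      have hev : Even h.length := hl ▸ even_two_mul n
      rw [if_pos hev] at f2
      rw [List.length_cons, if_neg (by simpa [Nat.even_add_one] using hev)] at f3
      rw [descentCount_cons, descentCount_cons, vopCount, gaps, gaps, f3.1, f3.2]
      obtain ⟨b, c, l⟩ := s
      cases b <;> cases c <;> simp at f2 ⊢ <;> omega

theorem IsHistoryOf.unique {m : ℕ} {σ : Equiv.Perm (Fin m)} {h h' : List Step}
    (H : IsHistoryOf σ h) (H' : IsHistoryOf σ h') : h = h' :=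
  build_injective H.valid H'.valid (H.length.trans H'.length.symm) (by rw [H.length]; omega)
    (H.build.trans H'.build.symm)

theorem IsHistoryOf.perm_unique {m : ℕ} {σ τ : Equiv.Perm (Fin m)} {h : List Step}
    (H : IsHistoryOf σ h) (H' : IsHistoryOf τ h) : σ = τ :=
  word_injective (H.build.symm.trans H'.build)

variable {n : ℕ} {σ : Equiv.Perm (Fin (2 * n + 1))}

theorem IsHistoryOf.isF_iff {h : List Step} (H : IsHistoryOf σ h) : IsF n σ ↔ IsFHistory h := by
  have hlast : entry σ (2 * n + 1 + 1) = 0 := by simp [entry]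
  have hlast' := entry_mem σ (i := 2 * n + 1) (by omega) le_rfl
  rw [isFHistory_iff, H.length]
  constructor
  · rintro ⟨⟨h1, h2⟩, h3, h4⟩ x hx
    have hdd : ¬ ((stepAt h x).1 = true ∧ (stepAt h x).2.1 = false) := fun hs => by
      have := H.mem_doubleDescents.2 ⟨mem_Icc.1 hx, hs⟩
      simp [h3] at this
    split_ifs with hodd
    · intro hb
      simpa [hb] using hdd
    · rw [mem_Icc] at hx
      obtain ⟨i, hi, hi', rfl⟩ := exists_entry_eq σ hx.1 hx.2
      have d := H.data hi hi'
      have hdes : ∀ j, 1 ≤ j → j < 2 * n + 1 → entry σ (j + 1) < entry σ j →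
          Odd (entry σ j) ∧ Odd (entry σ (j + 1)) := fun j h5 h6 h7 =>
        h1 j (by simp only [descents, mem_filter, mem_Ico]; exact ⟨⟨h5, h6⟩, h7⟩)
      constructor
      · rw [← Bool.not_eq_true, ← d.1]
        intro hlt
        have hi1 : i ≠ 1 := by
          rintro rfl
          simp [entry_zero] at hlt
        have e : i - 1 + 1 = i := by omega
        have := hdes (i - 1) (by omega) (by omega) (by rwa [e])
        rw [e] at this
        exact hodd this.2
      · rw [← Bool.not_eq_false, ← d.2.2.2]
        intro hlt
        -- A smaller right neighbour is either a genuine descent or the convention 0 after the last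
        -- entry; both force the value to be odd.
        rcases hi'.lt_or_eq with hi' | rfl
        · exact hodd (hdes i hi hi' hlt).1
        · exact hodd h2
  · intro hx
    have hx : ∀ i, 1 ≤ i → i ≤ 2 * n + 1 → _ := fun i hi hi' =>
      hx (entry σ i) (mem_Icc.2 (entry_mem σ hi hi'))
    have hlastc := (H.data (i := 2 * n + 1) (by omega) le_rfl).2.2.2.1 (by rw [hlast]; omega)
    have hodd : ∀ i, 1 ≤ i → i ≤ 2 * n + 1 →
        ((stepAt h (entry σ i)).1 = true ∨ (stepAt h (entry σ i)).2.1 = false) →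
        Odd (entry σ i) := by
      intro i hi hi' hs
      by_contra hne
      have := hx i hi hi'
      rw [if_neg hne] at this
      simp [this.1, this.2] at hs
    have hlastodd := hodd (2 * n + 1) (by omega) le_rfl (Or.inr hlastc)
    refine ⟨⟨?_, hlastodd⟩, ?_, ?_⟩
    · intro i hi
      simp only [descents, mem_filter, mem_Ico] at hi
      exact ⟨hodd i (by omega) (by omega) (Or.inr ((H.data (by omega) (by omega)).2.2.2.1 hi.2)),
        hodd (i + 1) (by omega) (by omega) (Or.inl ((H.data (by omega) (by omega)).1.1 hi.2))⟩
    · refine eq_empty_of_forall_notMem fun x hxd => ?_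
      obtain ⟨h1, h2, h3⟩ := H.mem_doubleDescents.1 hxd
      obtain ⟨i, hi, hi', rfl⟩ := exists_entry_eq σ h1.1 h1.2
      have := hx i hi hi'
      split_ifs at this
      · simp [this h2] at h3
      · simp [this.1] at h2
    -- The last entry is followed by 0, so a larger left neighbour would make it a double descent.
    · have := hx (2 * n + 1) (by omega) le_rfl
      rw [if_pos hlastodd] at this
      refine (H.data (i := 2 * n + 1) (by omega) le_rfl).2.2.1.2 ?_
      rw [← Bool.not_eq_true]
      intro hb
      simp [this hb] at hlastc

theorem IsHistoryOf.isNormalizedF_iff {s : Step} {h : List Step} (H : IsHistoryOf σ (s :: h)) :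
    IsNormalizedF n σ ↔ IsFHistory (s :: h) ∧ IsNormalizedHistory h := by
  have hl : h.length = 2 * n := by simpa using H.length
  rw [IsNormalizedF, H.isF_iff, isNormalizedHistory_iff hl]
  refine and_congr_right fun _ => forall₂_congr fun i hi => ?_
  rw [mem_Icc] at hi
  have h1 : IsVOP σ i ↔ (stepAt h (2 * i - 1)).1 = (stepAt h (2 * i - 1)).2.1 := by
    rw [IsVOP, H.mem_valleys, H.mem_peaks, stepAt_cons s (by omega)]
    have : 1 ≤ 2 * i - 1 ∧ 2 * i - 1 ≤ 2 * n + 1 := by omega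
    cases (stepAt h (2 * i - 1)).1 <;> cases (stepAt h (2 * i - 1)).2.1 <;> simp [this]
  have h2 : pairEmbracing σ i = if Even (gapsAt h (2 * i - 1)) then (stepAt h (2 * i - 1)).2.2
        else (stepAt h (2 * i)).2.2 := by
    rw [pairEmbracing, H.height_eq (by omega) (by omega), (H.embracings (by omega) (by omega)).1,
      (H.embracings (by omega) (by omega)).1, stepAt_cons s (by omega), stepAt_cons s (by omega),
      gapsAt_cons s (by omega)]
    simp only [Int.even_coe_nat]
  rw [h1, h2]

/-- The last value is odd and must close all gaps. Only a peak lowers the number of gaps, by one, so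
it fills the unique remaining gap. -/
theorem isFHistory_cons_last_iff {s : Step} {h : List Step} (hl : h.length = 2 * n)
    (hv : Valid (s :: h)) :
    (IsFHistory (s :: h) ∧ gaps (s :: h) = 0) ↔
      s = (false, false, 0) ∧ IsFHistory h ∧ gaps h = 1 := by
  obtain ⟨b, c, l⟩ := s
  have h2 := hv.2
  have hev : Even h.length := hl ▸ even_two_mul n
  simp only [IsFHistory, hev, if_true, gaps, Prod.mk.injEq] at h2 ⊢
  cases b <;> cases c <;> simp <;> grind

theorem IsHistoryOf.exists_eq_cons {h : List Step} (H : IsHistoryOf σ h) (hF : IsFHistory h) :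
    ∃ h', h = (false, false, 0) :: h' ∧ h' ∈ histories (2 * n) ∧ IsFHistory h' ∧ gaps h' = 1 ∧
      vopCount h' = 2 * des σ ∧ res σ = resSum h' ∧ les σ = lesSum h' := by
  match h, H.length with
  | s :: h, hl' =>
    have hl : h.length = 2 * n := by simpa using hl'
    clear hl'
    obtain ⟨rfl, h1, h2⟩ := (isFHistory_cons_last_iff hl H.valid).1 ⟨hF, H.gaps_eq_zero⟩
    refine ⟨h, rfl, mem_histories.2 ⟨hl, H.valid.1⟩, h1, h2, ?_, ?_, ?_⟩
    · have h3 := two_mul_descentCount_add_one hl H.valid.1 h1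
      have h4 : des σ = descentCount ((false, false, 0) :: h) := by
        rw [H.des_eq, descentCount, H.length]
      rw [descentCount_cons] at h4
      simp at h4
      omega
    · rw [H.res_eq, resSum, h2]
      simp
    · rw [H.les_eq, lesSum]
      simp

/-! ### Transfer of the sums and the theorem -/

theorem sum_perm_eq_sum_histories {R : Type*} [AddCommMonoid R] (k : ℕ) (f : ℕ → ℕ → R)
    (P : Equiv.Perm (Fin (2 * n + 1)) → Prop) (Q : List Step → Prop) [DecidablePred P]
    [DecidablePred Q] [DecidablePred IsFHistory]
    (hPQ : ∀ σ s h, IsHistoryOf σ (s :: h) → (P σ ↔ IsFHistory (s :: h) ∧ Q h)) :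
    ∑ σ with P σ ∧ des σ = k, f (res σ) (les σ) =
      ∑ h ∈ histories (2 * n) with IsFHistory h ∧ Q h ∧ gaps h = 1 ∧ vopCount h = 2 * k,
        f (resSum h) (lesSum h) := by
  have hhist := fun σ : Equiv.Perm (Fin (2 * n + 1)) => exists_isHistoryOf σ (by omega)
  choose H hH using hhist
  have key : ∀ σ, P σ → ∃ h', H σ = (false, false, 0) :: h' ∧ h' ∈ histories (2 * n) ∧
      IsFHistory h' ∧ gaps h' = 1 ∧ vopCount h' = 2 * des σ ∧ res σ = resSum h' ∧
      les σ = lesSum h' ∧ Q h' := fun σ hσ => by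
    have hs : ∃ s h, H σ = s :: h := List.exists_cons_of_length_pos (by rw [(hH σ).length]; omega)
    obtain ⟨s, h, hs⟩ := hs
    have h1 := (hPQ σ s h (hs ▸ hH σ)).1 hσ
    obtain ⟨h', h2, h3⟩ := (hH σ).exists_eq_cons (hs ▸ h1.1)
    obtain ⟨-, rfl⟩ := List.cons.inj (hs.symm.trans h2)
    exact ⟨h, h2, by tauto⟩
  -- The step of 2n + 1 is always the same and contributes to neither statistic, so dropping it
  -- loses nothing and leaves a history made of whole pairs.
  refine sum_bij (fun σ _ => (H σ).tail) ?_ ?_ ?_ ?_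
  · intro σ hσ
    rw [mem_filter] at hσ ⊢
    obtain ⟨h', e, h1, h2, h3, h4, -, -, h5⟩ := key σ hσ.2.1
    rw [e, List.tail_cons]
    exact ⟨h1, h2, h5, h3, hσ.2.2 ▸ h4⟩
  · intro σ hσ τ hτ hst
    rw [mem_filter] at hσ hτ
    obtain ⟨h', e, -⟩ := key σ hσ.2.1
    obtain ⟨h'', e', -⟩ := key τ hτ.2.1
    rw [e, e', List.tail_cons, List.tail_cons] at hst
    subst hst
    exact (e ▸ hH σ).perm_unique (e' ▸ hH τ)
  · intro h hh
    rw [mem_filter, mem_histories] at hh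
    obtain ⟨⟨h1, h2⟩, h3, h4, h5, h6⟩ := hh
    have hv : Valid ((false, false, 0) :: h) := ⟨h2, by simp [h5]⟩
    have hF := (isFHistory_cons_last_iff h1 hv).2 ⟨rfl, h3, h5⟩
    obtain ⟨σ, hσ⟩ := exists_perm_of_history (m := 2 * n + 1) (by simp [h1]) hv hF.2
    have hP := (hPQ σ _ _ hσ).2 ⟨hF.1, h4⟩
    have e := (hH σ).unique hσ
    obtain ⟨h', e', -, -, -, h7, -⟩ := key σ hP
    obtain ⟨-, rfl⟩ := List.cons.inj (e.symm.trans e')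
    refine ⟨σ, mem_filter.2 ⟨mem_univ _, hP, by omega⟩, by rw [e, List.tail_cons]⟩
  · intro σ hσ
    rw [mem_filter] at hσ
    obtain ⟨h', e, -, -, -, -, h1, h2, -⟩ := key σ hσ.2.1
    rw [e, List.tail_cons, h1, h2]

theorem two_mul_le_res {k : ℕ} (hσ : σ ∈ normalizedFPerms n k) : 2 * k ≤ res σ := by
  rw [normalizedFPerms, mem_filter] at hσ
  obtain ⟨-, hN, rfl⟩ := hσ
  obtain ⟨h, H⟩ := exists_isHistoryOf σ (by omega)
  obtain ⟨h', rfl, h1, -, -, h2, h3, -⟩ := H.exists_eq_cons (H.isF_iff.1 hN.1)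
  rw [mem_histories] at h1
  rw [← h2, h3]
  exact vopCount_le_resSum h1.1 h1.2 (H.isNormalizedF_iff.1 hN).2

end OddOdd

theorem mainTheorem7 (n k : ℕ) :
    (∀ σ ∈ OddOdd.normalizedFPerms n k, 2 * k ≤ OddOdd.res σ) ∧
    ∀ {R : Type*} [CommSemiring R] (p q : R),
      OddOdd.gammaCoeff n k 1 p q =
        (p + q) ^ (2 * k) *
          ∑ σ ∈ OddOdd.normalizedFPerms n k, p ^ (OddOdd.res σ - 2 * k) * q ^ OddOdd.les σ := by
  classical
  refine ⟨fun σ hσ => OddOdd.two_mul_le_res hσ, fun {R} _ p q => ?_⟩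
  have h1 := OddOdd.sum_perm_eq_sum_histories k (fun r l => p ^ r * q ^ l) (OddOdd.IsF n)
    (fun _ => True) fun σ s h H => by rw [H.isF_iff, and_true]
  have h2 := OddOdd.sum_perm_eq_sum_histories k (fun r l => p ^ (r - 2 * k) * q ^ l)
    (OddOdd.IsNormalizedF n) OddOdd.IsNormalizedHistory fun σ s h H => H.isNormalizedF_iff
  -- The indicator weight selects the histories with one gap left and 2k VOP pairs, on which the
  -- extracted factor is constant.
  have h3 := OddOdd.sum_fHistories_eq p q n fun a v => if a = 1 ∧ v = 2 * k then 1 else 0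
  rw [OddOdd.gammaCoeff, OddOdd.FPerms, OddOdd.normalizedFPerms, h2]
  simp only [one_pow, one_mul]
  rw [h1, Finset.mul_sum, Finset.sum_filter, Finset.sum_filter]
  convert h3 using 2 with h _ h _
  · split_ifs <;> simp_all
  · split_ifs <;> simp_all
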